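/- **Model.** A capacitated graph is a finite connected simple graph $G=(V,E)$ on $n$ anonymous nodes with a capacity function $c:V\to\{0,1,\dots,k^p\}$ such that $\sum_{v}c(v)\ge k$; at each node $v$ the incident edges carry the local port numbers $0,\dots,\deg(v)-1$. There are $k>1$ robots with pairwise distinct IDs in $[1,k^q]$; here $p,q$ are positive constants. One robot is the shepherd: it is never Byzantine, and a robot recognizes with certainty whether a co-located robot is the shepherd. At most $f$ robots are strong Byzantine. Time proceeds in synchronous rounds, and all robots start at the same time. In each round every robot shows an ID and shouts one message (of any size, or none) to all robots on its node. Each robot perceives its node's degree and capacity, the port through which it has just entered, and, for each co-located robot, the shown ID, the message, and whether that robot is the shepherd. It then performs local computation with unlimited memory, and stays, moves through a port to a neighbour, or terminates; a terminated robot stays at its node, silent, forever. Non-Byzantine robots follow the deterministic algorithm and show their true ID; Byzantine robots may show any ID, shout any message and make any move along edges, but each shows one ID and one message per round, heard alike by all robots on its node. Initially a robot knows only its own ID and whether it is the shepherd; the shepherd moreover knows $n$ and $k$. Neither the graph, nor $c$, nor $f$ is known to any robot. Byzantine dispersion is solved within $T$ rounds if, whatever the Byzantine robots do, after some number $t\le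 T$ of rounds all non-Byzantine robots have terminated and every node $u$ carries at most $c(u)$ non-Byzantine robots. **Corollary.** There exist a deterministic algorithm and an absolute constant $C$ such that for all $n$, $k$ and all $f<\lfloor (k-1)/2\rfloor$, if all $k$ robots are initially gathered at one node of a capacitated graph with $n$ nodes and at most $f$ of them are strong Byzantine, then the algorithm solves Byzantine dispersion within $C\,n^3$ rounds. -/

import Mathlib

namespace ByzantineDispersion

/-- A simple graph with a local port numbering: the edges at `v` are numbered
`0, …, deg v - 1`, independently at each node (so `deg v` is the degree of `v`). -/
structure PortGraph (V : Type) where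
  graph : SimpleGraph V
  deg : V → ℕ
  port : (v : V) → Fin (deg v) ≃ graph.neighborSet v

/-- Leaving `v` through port `p`: the node reached and the port there through which it is
entered; `none` if `v` has no port `p`. -/
def PortGraph.traverse {V : Type} (G : PortGraph V) (v : V) (p : ℕ) : Option (V × ℕ) :=
  if h : p < G.deg v then
    some ((G.port v ⟨p, h⟩).1,
      ((G.port (G.port v ⟨p, h⟩).1).symm ⟨v, (G.port v ⟨p, h⟩).2.symm⟩).1)
  else none

/-- What a robot perceives of the (anonymous) node it is on. -/
structure View where
  degree : ℕ
  capacity : ℕ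
  /-- The port through which the robot entered in the preceding round; `none` if it did not
  move in that round. -/
  entry : Option ℕ

/-- What a robot perceives of one co-located robot in one round: whether it is the shepherd,
the label (ID) it shows, and what it shouts (`none` if it is silent). -/
structure Shout (Msg : Type) where
  isShepherd : Bool
  label : ℕ
  msg : Option Msg

/-- What a robot may decide to do at the end of a round. -/
inductive Action where
  | stay
  | move (port : ℕ)
  | terminate

/-- A deterministic distributed algorithm for robots with unlimited memory. The shepherd
initially knows `n`, `k` and its ID; every other robot initially knows only its ID. In each
round a robot shouts `speak state view`, and then computes its new state and its action from its
state, its view and the multiset of what it perceives of the co-located other robots. -/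
structure Algorithm where
  State : Type
  Msg : Type
  initShepherd : (n k id : ℕ) → State
  initRobot : (id : ℕ) → State
  speak : State → View → Msg
  step : State → View → Multiset (Shout Msg) → State × Action

/-- `k` robots on a capacitated graph: their IDs, the shepherd, the Byzantine robots and the
starting nodes. -/
structure Instance (V : Type) (k : ℕ) where
  net : PortGraph V
  cap : V → ℕ
  id : Fin k → ℕ
  shepherd : Fin k
  byz : Finset (Fin k)
  start : Fin k → V

/-- The standing assumptions: connected graph, total capacity at least `k`, capacities in
`[0, k ^ p]`, unique IDs in `[1, k ^ q]`, a shepherd that is not Byzantine, and at most `f`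
Byzantine robots. -/
structure Instance.Valid {V : Type} [Fintype V] {k : ℕ} (I : Instance V k) (f p q : ℕ) :
    Prop where
  connected : I.net.graph.Connected
  total_cap : k ≤ ∑ v, I.cap v
  cap_le : ∀ v, I.cap v ≤ k ^ p
  id_injective : Function.Injective I.id
  id_mem : ∀ i, I.id i ∈ Set.Icc 1 (k ^ q)
  shepherd_honest : I.shepherd ∉ I.byz
  card_byz_le : I.byz.card ≤ f

/-- All robots start at one node. -/
def Instance.Gathered {V : Type} {k : ℕ} (I : Instance V k) : Prop :=
  ∃ r : V, ∀ i, I.start i = r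

/-- A behaviour of the strong Byzantine robots: in each round, the label each of them shows, what
it shouts, and the port through which it leaves (`none`: it stays). These are arbitrary; since
the honest robots are deterministic, quantifying over all such sequences covers every adaptive
and coordinated adversary. (The values at non-Byzantine robots are not used.) -/
structure Adversary (Msg : Type) (k : ℕ) where
  label : ℕ → Fin k → ℕ
  msg : ℕ → Fin k → Option Msg
  exit : ℕ → Fin k → Option ℕ

/-- The situation of one robot. `memory = none` means that the robot has terminated. (The memory
of a Byzantine robot plays no role.) -/
structure RobotState (State V : Type) where
  loc : V
  entry : Option ℕ
  memory : Option State

section Execution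

variable {V : Type} {k : ℕ} (A : Algorithm) (I : Instance V k)
  (adv : Adversary A.Msg k)

/-- The situation of robot `i` before the first round. -/
def initial [Fintype V] (i : Fin k) : RobotState A.State V where
  loc := I.start i
  entry := none
  memory := some (if i = I.shepherd then A.initShepherd (Fintype.card V) k (I.id i)
    else A.initRobot (I.id i))

/-- The view of a robot on its current node. -/
def viewOf {State : Type} (x : RobotState State V) : View where
  degree := I.net.deg x.loc
  capacity := I.cap x.loc
  entry := x.entry

/-- What robot `j` shows and shouts in round `t`. A terminated robot is silent. -/
def shoutOf (t : ℕ) (cfg : Fin k → RobotState A.State V) (j : Fin k) : Shout A.Msg where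
  isShepherd := decide (j = I.shepherd)
  label := if j ∈ I.byz then adv.label t j else I.id j
  msg := if j ∈ I.byz then adv.msg t j
    else (cfg j).memory.map fun s => A.speak s (viewOf I (cfg j))

open Classical in
/-- What robot `i` perceives of the other robots on its node in round `t`. -/
noncomputable def heard (t : ℕ) (cfg : Fin k → RobotState A.State V) (i : Fin k) :
    Multiset (Shout A.Msg) :=
  (Finset.univ.filter fun j => j ≠ i ∧ (cfg j).loc = (cfg i).loc).val.map
    (shoutOf A I adv t cfg)

/-- A robot at `v` leaves through port `p`, with memory `mem` afterwards; it stays if there is no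
such port. -/
def depart {State : Type} (v : V) (p : ℕ) (mem : Option State) : RobotState State V :=
  match I.net.traverse v p with
  | some (w, r) => ⟨w, some r, mem⟩
  | none => ⟨v, none, mem⟩

/-- The situation of robot `i` after round `t`, where `cfg` is the configuration before it. -/
noncomputable def next (t : ℕ) (cfg : Fin k → RobotState A.State V) (i : Fin k) :
    RobotState A.State V :=
  if i ∈ I.byz then
    match adv.exit t i with
    | some p => depart I (cfg i).loc p (cfg i).memory
    | none => ⟨(cfg i).loc, none, (cfg i).memory⟩
  else
    match (cfg i).memory with
    | none => cfg i
    | some s =>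
      match A.step s (viewOf I (cfg i)) (heard A I adv t cfg i) with
      | (s', Action.stay) => ⟨(cfg i).loc, none, some s'⟩
      | (s', Action.move p) => depart I (cfg i).loc p (some s')
      | (_, Action.terminate) => ⟨(cfg i).loc, none, none⟩

/-- The configuration after `t` rounds. -/
noncomputable def config [Fintype V] : ℕ → Fin k → RobotState A.State V
  | 0 => initial A I
  | t + 1 => next A I adv t (config t)

open Classical in
/-- After `t` rounds, all non-Byzantine robots have terminated, and every node `u` carries at most
`c(u)` of them. (Terminated robots never move again.) -/
def DispersedAt [Fintype V] (t : ℕ) : Prop :=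
  (∀ i, i ∉ I.byz → (config A I adv t i).memory = none) ∧
  ∀ u : V, (Finset.univ.filter fun i => i ∉ I.byz ∧ (config A I adv t i).loc = u).card ≤ I.cap u

/-- The algorithm solves Byzantine dispersion on the instance within `T` rounds, whatever the
Byzantine robots do. -/
def SolvesWithin [Fintype V] (T : ℕ) : Prop :=
  ∀ adv : Adversary A.Msg k, ∃ t ≤ T, DispersedAt A I adv t

end Execution

end ByzantineDispersion

/-! The honest robots other than the shepherd form a flock that moves only on the shepherd's order.
The shepherd cannot be impersonated, so the flock stays together whatever the Byzantine robots do.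
The bound on `f` gives `2f + 3 ≤ k`: on the node of the flock the shepherd meets at least `k - 1 - f
≥ k/2` robots, elsewhere at most `f < k/2`. Counting therefore tells whether the flock is present
(`Simulates.observes`), and the flock is a reliable movable token.

One token suffices to map an anonymous graph. When a node `y` is discovered, the flock is parked
there while the shepherd tries every port of every recorded node; a port behind which it meets the
flock belongs to an edge to `y` (`within_probe`). Hence exactly the ports between recorded nodes are
marked, and any other port leads to a new node. A survey costs `O(n²)` rounds and fewer than `n`
nodes are discovered, so the map is complete in `O(n³)` rounds (`within_explore`).

The labels heard in the first round, together with the shepherd's own, number at most `k` and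
include all honest IDs. Distinct labels get distinct places on the map, a node offering as many
places as its capacity (`card_assign_le`); invented labels merely waste places.

The shepherd's part is an interactive program. `Within` is its total correctness with a budget of
rounds, for all observations compatible with `Observes`; this interface hides the adversary.
`Simulates.exists_of_within` transfers such statements to the execution. -/

namespace ByzantineDispersion

/-! ### Walking in a port-numbered graph -/

namespace PortGraph

variable {V : Type} (G : PortGraph V)

lemma traverse_eq_some_iff {u v : V} {p r : ℕ} :
    G.traverse u p = some (v, r) ↔
      ∃ (hp : p < G.deg u) (hr : r < G.deg v),
        (G.port u ⟨p, hp⟩).1 = v ∧ (G.port v ⟨r, hr⟩).1 = u := by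
  unfold traverse
  constructor
  · intro h
    split_ifs at h with hp
    simp only [Option.some.injEq, Prod.mk.injEq] at h
    obtain ⟨rfl, rfl⟩ := h
    exact ⟨hp, Fin.isLt _, rfl, by simp⟩
  · rintro ⟨hp, hr, rfl, h⟩
    rw [dif_pos hp]
    simp only [Option.some.injEq, Prod.mk.injEq, true_and]
    have : (G.port (G.port u ⟨p, hp⟩).1).symm ⟨u, (G.port u ⟨p, hp⟩).2.symm⟩ = ⟨r, hr⟩ := by
      rw [Equiv.symm_apply_eq]
      exact Subtype.ext h.symm
    rw [this]

lemma traverse_symm {u v : V} {p r : ℕ} (h : G.traverse u p = some (v, r)) :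
    G.traverse v r = some (u, p) := by
  rw [traverse_eq_some_iff] at h ⊢
  obtain ⟨hp, hr, h₁, h₂⟩ := h
  exact ⟨hr, hp, h₂, h₁⟩

lemma lt_deg_of_traverse {u v : V} {p r : ℕ} (h : G.traverse u p = some (v, r)) :
    p < G.deg u :=
  (G.traverse_eq_some_iff.1 h).1

lemma exists_traverse {u : V} {p : ℕ} (h : p < G.deg u) :
    ∃ v r, G.traverse u p = some (v, r) := by
  simp [traverse, h]

lemma adj_of_traverse {u v : V} {p r : ℕ} (h : G.traverse u p = some (v, r)) :
    G.graph.Adj u v := by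
  obtain ⟨hp, _, rfl, _⟩ := G.traverse_eq_some_iff.1 h
  exact (G.port u ⟨p, hp⟩).2

lemma exists_traverse_of_adj {u v : V} (h : G.graph.Adj u v) :
    ∃ p r, G.traverse u p = some (v, r) := by
  refine ⟨((G.port u).symm ⟨v, h⟩).1, ((G.port v).symm ⟨u, h.symm⟩).1, ?_⟩
  rw [traverse_eq_some_iff]
  exact ⟨Fin.isLt _, Fin.isLt _, by simp, by simp⟩

lemma deg_le_card [Fintype V] (u : V) : G.deg u ≤ Fintype.card V := by
  simpa using Fintype.card_le_of_injective (fun p => (G.port u p).1)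
    (Subtype.val_injective.comp (G.port u).injective)

/-- The node reached from `v` by leaving through the listed ports in turn. -/
def follow (v : V) : List ℕ → Option V
  | [] => some v
  | p :: ps => (G.traverse v p).bind fun q => follow q.1 ps

lemma follow_cons_eq_some {u v : V} {p : ℕ} {ps : List ℕ} :
    G.follow u (p :: ps) = some v ↔ ∃ w r, G.traverse u p = some (w, r) ∧ G.follow w ps = some v := by
  simp [follow, Option.bind_eq_some_iff]

lemma follow_append {u v : V} {ps qs : List ℕ} (h : G.follow u ps = some v) :
    G.follow u (ps ++ qs) = G.follow v qs := by
  induction ps generalizing u with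
  | nil => simp only [follow, Option.some.injEq] at h; simp [h]
  | cons p ps ih =>
    obtain ⟨w, r, hw, h⟩ := G.follow_cons_eq_some.1 h
    simp [follow, hw, ih h]

end PortGraph

/-! ### Programs of the shepherd -/

/-- What the shepherd perceives in one round: its node, and the labels of the other robots there. -/
structure Observation where
  view : View
  labels : Multiset ℕ

/-- What the shepherd may do in one round of a program: stay, walk alone, or walk together with
the robots on its node. -/
inductive Move where
  | stay
  | solo (port : ℕ)
  | lead (port : ℕ)

/-- An interactive program: in each round a move is made, and the program goes on depending on
the observation made before the move. -/
inductive Prog (α : Type) : Type where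
  | ret (a : α)
  | act (m : Move) (next : Observation → Prog α)

namespace Prog

/-- Sequential composition. -/
def andThen {α β : Type} : Prog α → (α → Prog β) → Prog β
  | ret a, f => f a
  | act m κ, f => act m fun o => (κ o).andThen f

instance : Monad Prog where
  pure := ret
  bind := andThen

/-- Stay for one round and report the observation. -/
def observe : Prog Observation := act .stay ret

/-- Make a move and report the observation at the node reached. -/
def go (m : Move) : Prog Observation := act m fun _ => observe

/-- Leave through the listed ports in turn. -/
def walk (move : ℕ → Move) : List ℕ → Prog Unit
  | [] => ret ()
  | p :: ps => act (move p) fun _ => walk move ps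

/-- Run `f` on all elements of a list and join the results. -/
def collect {β γ : Type} (f : β → Prog (List γ)) : List β → Prog (List γ)
  | [] => pure []
  | b :: l => do
    let r ← f b
    let s ← collect f l
    pure (r ++ s)

end Prog

/-! ### The algorithm -/

/-- What the shepherd records of a node: ports leading there from the root, ports leading back to
the root, degree and capacity. -/
structure Record where
  path : List ℕ
  back : List ℕ
  degree : ℕ
  capacity : ℕ

/-- A port of a recorded node; the node is given by the path to it. -/
abbrev PortMark := List ℕ × ℕ

open Prog

/-- With the flock on the node `y` and the shepherd on the node `x`: if port `p` leads to the
flock, report this port and the port at `y` leading back. The flock is recognized by the number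
of robots. -/
def probe (k : ℕ) (y x : Record) (p : ℕ) : Prog (List PortMark) := do
  let o ← go (.solo p)
  -- The default `0` is never used: after a move through an existing port, `entry` is the port
  -- leading back.
  walk .solo [o.view.entry.getD 0]
  pure (if k ≤ 2 * o.labels.card then [(x.path, p), (y.path, o.view.entry.getD 0)] else [])

/-- Starting from the root, probe all ports of the node `x`, and return to the root. -/
def inspect (k : ℕ) (y x : Record) : Prog (List PortMark) := do
  walk .solo x.path
  let m ← collect (probe k y x) (List.range x.degree)
  walk .solo x.back
  pure m

/-- With the flock and the shepherd on the node `y`: find the ports connecting `y` with the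
recorded nodes, then lead the flock to the root. -/
def survey (k : ℕ) (y : Record) (N : List Record) : Prog (List PortMark) := do
  -- The flock stays behind on `y` as the token.
  walk .solo y.back
  let m ← collect (inspect k y) N
  walk .solo y.path
  walk .lead y.back
  pure m

/-- Lead the flock from the root through port `p` of the node `x`, and record the node reached. -/
def discover (x : Record) (p : ℕ) : Prog Record := do
  walk .lead x.path
  let o ← go (.lead p)
  pure ⟨x.path ++ [p], o.view.entry.getD 0 :: x.back, o.view.degree, o.view.capacity⟩

/-- A port of a recorded node that is not marked. -/
def openPort (N : List Record) (M : List PortMark) : Option (Record × ℕ) :=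
  (N.flatMap fun x => (List.range x.degree).map fun p => (x, p)).find?
    fun xp => (xp.1.path, xp.2) ∉ M

/-- Record new nodes as long as there are unmarked ports, at most `t` of them. The marked ports
are those between recorded nodes. -/
def explore (k : ℕ) : ℕ → List Record → List PortMark → Prog (List Record)
  | 0, N, _ => pure N
  | t + 1, N, M =>
    match openPort N M with
    | none => pure N
    | some (x, p) => do
      let y ← discover x p
      let m ← survey k y (y :: N)
      explore k t (y :: N) (m ++ M)

/-- The places offered by the recorded nodes, each node occurring as often as its capacity. -/
def slots (N : List Record) : List (Record × ℕ) :=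
  N.flatMap fun x => (List.range x.capacity).map fun c => (x, c)

/-- Assign the labels in `S` to distinct places; the value is the path to the place. -/
def assign (N : List Record) (S : Finset ℕ) (i : ℕ) : List ℕ :=
  -- For `i ∈ S` the default `[]` does not occur once there are at least `S.card` places.
  (((slots N)[(S.sort (· ≤ ·)).idxOf i]?).map fun s => s.1.path).getD []

/-- The program of the shepherd; its result tells each label the path to its final node. -/
def shepherdProg (n k id : ℕ) : Prog (ℕ → List ℕ) := do
  let o ← observe
  -- Fuel `n` suffices: one node is recorded already and there are only `n`.
  let N ← explore k n [⟨[], [], o.view.degree, o.view.capacity⟩] []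
  pure (assign N (insert id o.labels.toFinset))

/-- The memory of a robot: the shepherd executing its program, a member of the flock, or a robot
walking to its final node. -/
inductive Memory where
  | leading (id : ℕ) (P : Prog (ℕ → List ℕ))
  | following (id : ℕ)
  | walking (ps : List ℕ)

/-- The messages: orders of the shepherd. -/
inductive Order where
  | idle
  | follow (port : ℕ)
  | disperse (g : ℕ → List ℕ)

/-- The order given in the current round of a program. -/
def Prog.order : Prog (ℕ → List ℕ) → Order
  | ret g => .disperse g
  | act (.lead p) _ => .follow p
  | act _ _ => .idle

/-- The message shouted by a robot. -/
def Memory.speak : Memory → Order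
  | leading _ P => P.order
  | _ => .idle

/-- The action of a move of the shepherd. -/
def Move.action : Move → Action
  | stay => .stay
  | solo p => .move p
  | lead p => .move p

/-- A member of the flock obeying an order. -/
def obey (id : ℕ) : Order → Memory × Action
  | .idle => (.following id, .stay)
  | .follow p => (.following id, .move p)
  | .disperse g => (.walking (g id), .stay)

open Classical in
/-- The order of the shepherd among the shouts heard, `idle` if there is none. -/
noncomputable def heardOrder (h : Multiset (Shout Order)) : Order :=
  if H : ∃ c, ∃ s ∈ h, s.isShepherd = true ∧ s.msg = some c then H.choose else .idle

/-- The computation and action of a robot in one round. -/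
noncomputable def Memory.step : Memory → View → Multiset (Shout Order) → Memory × Action
  | leading id (.ret g), _, _ => (walking (g id), .stay)
  | leading id (.act m κ), view, h => (leading id (κ ⟨view, h.map Shout.label⟩), m.action)
  | following id, _, h => obey id (heardOrder h)
  | walking [], _, _ => (walking [], .terminate)
  | walking (p :: ps), _, _ => (walking ps, .move p)

/-- The dispersion algorithm. -/
noncomputable def dispersionAlgorithm : Algorithm where
  State := Memory
  Msg := Order
  initShepherd n k id := .leading id (shepherdProg n k id)
  initRobot id := .following id
  speak s _ := s.speak
  step := Memory.step

/-! ### Semantics of the programs -/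

/-- Where the shepherd and the flock are; `entry` is the port through which the shepherd has just
entered. -/
structure Situation (V : Type) where
  leader : V
  entry : Option ℕ
  flock : V

/-- The effect of a move of the shepherd. -/
inductive Situation.Step {V : Type} (G : PortGraph V) (w : Situation V) :
    Move → Situation V → Prop
  | stay : Step G w .stay ⟨w.leader, none, w.flock⟩
  | solo {p v r} (h : G.traverse w.leader p = some (v, r)) : Step G w (.solo p) ⟨v, some r, w.flock⟩
  | lead {p v r} (hw : w.leader = w.flock) (h : G.traverse w.leader p = some (v, r)) :
      Step G w (.lead p) ⟨v, some r, v⟩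

/-- What can be relied on in an observation, whatever the Byzantine robots do. -/
structure Situation.Observes {V : Type} {k : ℕ} (I : Instance V k) (w : Situation V)
    (o : Observation) : Prop where
  view : o.view = ⟨I.net.deg w.leader, I.cap w.leader, w.entry⟩
  card_lt : o.labels.card < k
  flock_iff : k ≤ 2 * o.labels.card ↔ w.leader = w.flock
  mem_labels : w.leader = w.flock → ∀ i ∉ I.byz, i ≠ I.shepherd → I.id i ∈ o.labels

/-- The program, started in the situation `w`, ends after at most `B` rounds with a result and a
situation satisfying `Q`. -/
def Prog.Within {V : Type} {k : ℕ} (I : Instance V k) {α : Type} :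
    Prog α → Situation V → ℕ → (α → Situation V → Prop) → Prop
  | ret a, w, _, Q => Q a w
  | act _ _, _, 0, _ => False
  | act m κ, w, B + 1, Q =>
    ∃ w', Situation.Step I.net w m w' ∧ ∀ o, w.Observes I o → (κ o).Within I w' B Q

/-! ### The execution of the algorithm follows the shepherd's program -/

section Simulation

/-- A robot on the node `v` carrying out an action. -/
def proceed {V : Type} {k : ℕ} (I : Instance V k) (v : V) : Memory × Action → RobotState Memory V
  | (s, .stay) => ⟨v, none, some s⟩
  | (s, .move p) => depart I v p (some s)
  | (_, .terminate) => ⟨v, none, none⟩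

lemma depart_of_traverse {V : Type} {k : ℕ} {I : Instance V k} {v w : V} {p r : ℕ}
    {m : Option Memory} (h : I.net.traverse v p = some (w, r)) :
    depart I v p m = ⟨w, some r, m⟩ := by
  simp [depart, h]

variable {V : Type} [Fintype V] {k : ℕ} (I : Instance V k) (adv : Adversary Order k)

/-- The configurations of the dispersion algorithm. -/
noncomputable def run (t : ℕ) (i : Fin k) : RobotState Memory V :=
  config dispersionAlgorithm I adv t i

/-- What robot `j` shouts in round `t` of the dispersion algorithm. -/
noncomputable def shouts (t : ℕ) (j : Fin k) : Shout Order where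
  isShepherd := decide (j = I.shepherd)
  label := if j ∈ I.byz then adv.label t j else I.id j
  msg := if j ∈ I.byz then adv.msg t j else (run I adv t j).memory.map Memory.speak

open Classical in
/-- What robot `i` hears in round `t` of the dispersion algorithm. -/
noncomputable def hears (t : ℕ) (i : Fin k) : Multiset (Shout Order) :=
  (Finset.univ.filter fun j => j ≠ i ∧ (run I adv t j).loc = (run I adv t i).loc).val.map
    (shouts I adv t)

/-- Before round `t`, the shepherd and the flock are in the situation `w`, and the shepherd is
about to execute the program `P`. -/
structure Simulates (t : ℕ) (w : Situation V) (P : Prog (ℕ → List ℕ)) : Prop where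
  shepherd : run I adv t I.shepherd =
    ⟨w.leader, w.entry, some (.leading (I.id I.shepherd) P)⟩
  loc : ∀ i ∉ I.byz, i ≠ I.shepherd → (run I adv t i).loc = w.flock
  memory : ∀ i ∉ I.byz, i ≠ I.shepherd →
    (run I adv t i).memory = some (.following (I.id i))

variable {I adv}

/-- Makes the arbitrary choice in `heardOrder` harmless: all shouts bearing the shepherd's mark
carry the same order. -/
lemma heardOrder_of_mem {h : Multiset (Shout Order)} {c : Order}
    (hex : ∃ s ∈ h, s.isShepherd = true)
    (hall : ∀ s ∈ h, s.isShepherd = true → s.msg = some c) : heardOrder h = c := by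
  obtain ⟨s, hs, hs'⟩ := hex
  have H : ∃ c, ∃ s ∈ h, s.isShepherd = true ∧ s.msg = some c := ⟨c, s, hs, hs', hall s hs hs'⟩
  rw [heardOrder, dif_pos H]
  obtain ⟨s', h₁, h₂, h₃⟩ := H.choose_spec
  exact Option.some.inj (h₃.symm.trans (hall s' h₁ h₂))

lemma heardOrder_of_forall_not {h : Multiset (Shout Order)}
    (hall : ∀ s ∈ h, s.isShepherd = false) : heardOrder h = .idle := by
  rw [heardOrder, dif_neg]
  rintro ⟨c, s, hs, h₁, -⟩
  simp [hall s hs] at h₁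

lemma run_succ {t : ℕ} {i : Fin k} {s : Memory} (hi : i ∉ I.byz)
    (hs : (run I adv t i).memory = some s) :
    run I adv (t + 1) i =
      proceed I (run I adv t i).loc (s.step (viewOf I (run I adv t i)) (hears I adv t i)) := by
  change next dispersionAlgorithm I adv t (run I adv t) i = _
  unfold next
  rw [if_neg hi]
  split
  · rename_i h
    cases h.symm.trans hs
  · rename_i s' h
    obtain rfl : s' = s := Option.some.inj (h.symm.trans hs)
    split <;> rename_i h' <;> exact (congrArg (proceed I (run I adv t i).loc) h').symm

namespace Simulates

variable {t : ℕ} {w : Situation V} {P : Prog (ℕ → List ℕ)}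

/-- Byzantine robots can fake labels but not their number. With `b` of them, the shepherd sees at
most `b` others away from the flock and at least `k - 1 - b` with it, and `2b < k ≤ 2(k - 1 - b)`.
-/
lemma observes (h : Simulates I adv t w P) (hs : I.shepherd ∉ I.byz) (hk : 2 * I.byz.card + 3 ≤ k) :
    w.Observes I ⟨viewOf I (run I adv t I.shepherd),
      (hears I adv t I.shepherd).map
        Shout.label⟩ := by
  classical
  have hl : (run I adv t I.shepherd).loc = w.leader := by rw [h.shepherd]
  set S := Finset.univ.filter fun j => j ≠ I.shepherd ∧
    (run I adv t j).loc = (run I adv t I.shepherd).loc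
    with hS
  have hheard : hears I adv t I.shepherd =
      S.val.map (shouts I adv t) := by
    unfold hears
    congr!
  have hcard : ((hears I adv t
      I.shepherd).map Shout.label).card = S.card := by
    rw [hheard]; simp
  have hsub : S ⊆ Finset.univ.erase I.shepherd := fun j hj => by simp_all
  have hsubcard := Finset.card_le_card hsub
  rw [Finset.card_erase_of_mem (Finset.mem_univ _), Finset.card_fin] at hsubcard
  have hmem : w.leader = w.flock → ∀ i ∉ I.byz, i ≠ I.shepherd → i ∈ S := fun e i hi hi' => by
    rw [hS, Finset.mem_filter, hl, h.loc i hi hi']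
    exact ⟨Finset.mem_univ _, hi', e.symm⟩
  refine ⟨by simp [viewOf, h.shepherd], by rw [hcard]; omega, ?_, fun e i hi hi' => ?_⟩
  · rw [hcard]
    constructor
    · intro hc
      by_contra hne
      have : S ⊆ I.byz := fun j hj => by
        by_contra hj'
        rw [hS, Finset.mem_filter] at hj
        rw [hl, h.loc j hj' hj.2.1] at hj
        exact hne hj.2.2.symm
      have := Finset.card_le_card this
      omega
    · intro e
      have : (Finset.univ \ insert I.shepherd I.byz) ⊆ S := fun j hj => by
        simp only [Finset.mem_sdiff, Finset.mem_univ, Finset.mem_insert, not_or, true_and] at hj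
        exact hmem e j hj.2 hj.1
      have := Finset.card_le_card this
      rw [Finset.card_sdiff_of_subset (Finset.subset_univ _), Finset.card_insert_of_notMem hs,
        Finset.card_fin] at this
      omega
  · rw [hheard]
    simp only [Multiset.map_map, Multiset.mem_map]
    exact ⟨i, hmem e i hi hi', by simp [shouts, hi]⟩

/-- The mark `isShepherd` depends on the robot itself and not on what it shows, so only the true
shepherd's shout counts. -/
lemma heardOrder_eq (h : Simulates I adv t w P) (hs : I.shepherd ∉ I.byz) {i : Fin k}
    (hi : i ∉ I.byz) (hi' : i ≠ I.shepherd) (e : w.leader = w.flock) :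
    heardOrder (hears I adv t i) =
      P.order := by
  refine heardOrder_of_mem ⟨shouts I adv t I.shepherd,
    Multiset.mem_map_of_mem _ ?_, by simp [shouts]⟩ ?_
  · simp only [Finset.mem_val, Finset.mem_filter, Finset.mem_univ, true_and]
    exact ⟨hi'.symm, by rw [h.shepherd, h.loc i hi hi', e]⟩
  · intro s hsm hsh
    obtain ⟨j, -, rfl⟩ := Multiset.mem_map.1 hsm
    obtain rfl : j = I.shepherd := by simpa [shouts] using hsh
    simp [shouts, hs, h.shepherd, Memory.speak]

lemma heardOrder_eq_idle (h : Simulates I adv t w P) {i : Fin k}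
    (hi : i ∉ I.byz) (hi' : i ≠ I.shepherd) (e : w.leader ≠ w.flock) :
    heardOrder (hears I adv t i) =
      .idle := by
  refine heardOrder_of_forall_not fun s hsm => ?_
  obtain ⟨j, hj, rfl⟩ := Multiset.mem_map.1 hsm
  simp only [Finset.mem_val, Finset.mem_filter, Finset.mem_univ, true_and] at hj
  rw [h.loc i hi hi'] at hj
  simp only [shouts, decide_eq_false_iff_not]
  rintro rfl
  rw [h.shepherd] at hj
  exact e hj.2

/-- One round of the execution carries out one round of the program. -/
lemma step {m : Move} {κ : Observation → Prog (ℕ → List ℕ)} {w' : Situation V}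
    (h : Simulates I adv t w (.act m κ)) (hs : I.shepherd ∉ I.byz) (hk : 2 * I.byz.card + 3 ≤ k)
    (hw : Situation.Step I.net w m w') :
    ∃ o, w.Observes I o ∧ Simulates I adv (t + 1) w' (κ o) := by
  refine ⟨_, h.observes hs hk, ?_⟩
  have hshep := run_succ (adv := adv) (t := t) hs (congrArg RobotState.memory h.shepherd)
  have hrest := fun i hi hi' => run_succ (adv := adv) (t := t) hi (h.memory i hi hi')
  -- When the shepherd does not lead, the flock stays for one of two reasons: it hears `idle`, or
  -- the shepherd is elsewhere and it hears no order.
  have hidle : (Prog.act m κ).order = .idle → ∀ i, i ∉ I.byz → i ≠ I.shepherd →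
      heardOrder (hears I adv t i) =
        .idle := fun ho i hi hi' => by
    by_cases e : w.leader = w.flock
    · rw [h.heardOrder_eq hs hi hi' e, ho]
    · exact h.heardOrder_eq_idle hi hi' e
  have hl : (run I adv t I.shepherd).loc = w.leader := by rw [h.shepherd]
  cases hw with
  | stay =>
    simp only [Memory.step, proceed, Move.action, hl] at hshep
    have hid := hidle rfl
    refine ⟨hshep, fun i hi hi' => ?_, fun i hi hi' => ?_⟩ <;>
    · have := hrest i hi hi'
      simp only [Memory.step, proceed, hid i hi hi', obey] at this
      rw [this]
      try exact h.loc i hi hi'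
  | solo hp =>
    simp only [Memory.step, proceed, Move.action, hl, depart_of_traverse hp] at hshep
    have hid := hidle rfl
    refine ⟨hshep, fun i hi hi' => ?_, fun i hi hi' => ?_⟩ <;>
    · have := hrest i hi hi'
      simp only [Memory.step, proceed, hid i hi hi', obey] at this
      rw [this]
      try exact h.loc i hi hi'
  | lead e hp =>
    simp only [Memory.step, proceed, Move.action, hl, depart_of_traverse hp] at hshep
    refine ⟨hshep, fun i hi hi' => ?_, fun i hi hi' => ?_⟩ <;>
    · have := hrest i hi hi'
      simp only [Memory.step, proceed, h.heardOrder_eq hs hi hi' e, Prog.order, obey, h.loc i hi hi', ← e,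
        depart_of_traverse hp] at this
      rw [this]

/-- The execution carries out the program. -/
lemma exists_of_within (hs : I.shepherd ∉ I.byz) (hk : 2 * I.byz.card + 3 ≤ k) {B : ℕ}
    {Q : (ℕ → List ℕ) → Situation V → Prop} (h : Simulates I adv t w P) (hP : P.Within I w B Q) :
    ∃ t' ≤ t + B, ∃ g w', Simulates I adv t' w' (.ret g) ∧ Q g w' := by
  induction P generalizing t w B with
  | ret g => exact ⟨t, by omega, g, w, h, hP⟩
  | act m κ ih =>
    cases B with
    | zero => exact hP.elim
    | succ B =>
      obtain ⟨w', hw, hκ⟩ := hP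
      obtain ⟨o, ho, h'⟩ := h.step hs hk hw
      obtain ⟨t', ht', H⟩ := ih o h' (hκ o ho)
      exact ⟨t', by omega, H⟩

/-- After the order to disperse, all non-Byzantine robots walk to their final nodes. -/
lemma disperse {g : ℕ → List ℕ} (h : Simulates I adv t w (.ret g)) (hs : I.shepherd ∉ I.byz)
    (e : w.leader = w.flock) (i : Fin k) (hi : i ∉ I.byz) :
    (run I adv (t + 1) i).loc = w.flock ∧
      (run I adv (t + 1) i).memory = some (.walking (g (I.id i))) := by
  by_cases hi' : i = I.shepherd
  · subst hi'
    have := run_succ (adv := adv) (t := t) hs (congrArg RobotState.memory h.shepherd)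
    simp only [Memory.step, proceed, h.shepherd] at this
    rw [this]
    exact ⟨e, rfl⟩
  · have := run_succ (adv := adv) (t := t) hi (h.memory i hi hi')
    simp only [Memory.step, proceed, h.heardOrder_eq hs hi hi' e, Prog.order, obey] at this
    rw [this]
    exact ⟨h.loc i hi hi', rfl⟩

end Simulates

lemma run_of_terminated {t : ℕ} {i : Fin k} (hi : i ∉ I.byz)
    (hm : (run I adv t i).memory = none) (d : ℕ) :
    run I adv (t + d) i = run I adv t i := by
  induction d with
  | zero => rfl
  | succ d ih =>
    rw [← ih] at hm
    rw [← ih]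
    change next dispersionAlgorithm I adv (t + d) (run I adv (t + d)) i = _
    unfold next
    rw [if_neg hi]
    split
    · rfl
    · rename_i s hs
      cases hs.symm.trans hm

/-- A robot walking to its final node gets there and terminates. -/
lemma run_of_walking {t : ℕ} {i : Fin k} (hi : i ∉ I.byz) {ps : List ℕ} {v : V}
    (hm : (run I adv t i).memory = some (.walking ps))
    (hv : I.net.follow (run I adv t i).loc ps = some v) {T : ℕ}
    (hT : t + ps.length + 1 ≤ T) :
    (run I adv T i).memory = none ∧
      (run I adv T i).loc = v := by
  induction ps generalizing t with
  | nil =>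
    obtain ⟨d, rfl⟩ := Nat.exists_eq_add_of_le hT
    have := run_succ (adv := adv) (t := t) hi hm
    simp only [Memory.step, proceed] at this
    have hc : run I adv (t + ([] : List ℕ).length + 1) i =
      ⟨(run I adv t i).loc, none, none⟩ := this
    rw [run_of_terminated hi (by rw [hc]), hc]
    exact ⟨rfl, Option.some.inj hv⟩
  | cons p ps ih =>
    obtain ⟨w, r, hw, hv⟩ := I.net.follow_cons_eq_some.1 hv
    have := run_succ (adv := adv) (t := t) hi hm
    simp only [Memory.step, proceed, depart_of_traverse hw] at this
    refine ih (t := t + 1) (by rw [this]) (by rw [this]; exact hv) ?_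
    simp only [List.length_cons] at hT
    omega

end Simulation

/-! ### Rules for reasoning about programs -/

namespace Prog

variable {V : Type} {k : ℕ} {I : Instance V k} {α β γ : Type} {w : Situation V}

lemma Within.mono {P : Prog α} {B B' : ℕ} {Q Q' : α → Situation V → Prop} (h : P.Within I w B Q)
    (hB : B ≤ B') (hQ : ∀ a w', Q a w' → Q' a w') : P.Within I w B' Q' := by
  induction P generalizing w B B' with
  | ret a => exact hQ _ _ h
  | act m κ ih =>
    cases B with
    | zero => exact h.elim
    | succ B =>
      obtain ⟨B', rfl⟩ : ∃ B'', B' = B'' + 1 := ⟨B' - 1, by omega⟩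
      obtain ⟨w', hw, hκ⟩ := h
      exact ⟨w', hw, fun o ho => ih o (hκ o ho) (by omega)⟩

lemma Within.bind {P : Prog α} {f : α → Prog β} {B C : ℕ} {Q : α → Situation V → Prop}
    {R : β → Situation V → Prop} (h : P.Within I w B Q)
    (hf : ∀ a w', Q a w' → (f a).Within I w' C R) : (P >>= f).Within I w (B + C) R := by
  induction P generalizing w B with
  | ret a => exact (hf a w h).mono (by omega) fun _ _ h => h
  | act m κ ih =>
    cases B with
    | zero => exact h.elim
    | succ B =>
      obtain ⟨w', hw, hκ⟩ := h
      rw [Nat.succ_add]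
      exact ⟨w', hw, fun o ho => ih o (hκ o ho)⟩

lemma within_pure {a : α} {Q : α → Situation V → Prop} (h : Q a w) :
    (pure a : Prog α).Within I w 0 Q := h

lemma within_observe {Q : Observation → Situation V → Prop}
    (h : ∀ o, w.Observes I o → Q o ⟨w.leader, none, w.flock⟩) : observe.Within I w 1 Q :=
  ⟨_, .stay, h⟩

/-- The second round is spent observing, which clears `entry`; the port of arrival survives only in
the reported observation. Hence only the two locations of `w''` are described. -/
lemma within_go {m : Move} {w' : Situation V} (h : w.Step I.net m w') :
    (go m).Within I w 2 fun o w'' =>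
      w'.Observes I o ∧ w''.leader = w'.leader ∧ w''.flock = w'.flock :=
  ⟨w', h, fun _ _ => within_observe fun _ ho => ⟨ho, rfl, rfl⟩⟩

lemma within_walk_solo {u v g : V} {ps : List ℕ} (h : I.net.follow u ps = some v)
    (hu : w.leader = u) (hg : w.flock = g) :
    (walk .solo ps).Within I w ps.length fun _ w' => w'.leader = v ∧ w'.flock = g := by
  induction ps generalizing u w with
  | nil => exact ⟨hu.trans (Option.some.inj h), hg⟩
  | cons p ps ih =>
    subst hu
    obtain ⟨u', r, hp, h⟩ := I.net.follow_cons_eq_some.1 h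
    exact ⟨_, .solo hp, fun _ _ => ih h rfl hg⟩

lemma within_walk_lead {u v : V} {ps : List ℕ} (h : I.net.follow u ps = some v)
    (hu : w.leader = u) (hg : w.flock = u) :
    (walk .lead ps).Within I w ps.length fun _ w' => w'.leader = v ∧ w'.flock = v := by
  induction ps generalizing u w with
  | nil => exact ⟨hu.trans (Option.some.inj h), hg.trans (Option.some.inj h)⟩
  | cons p ps ih =>
    subst hu
    obtain ⟨u', r, hp, h⟩ := I.net.follow_cons_eq_some.1 h
    exact ⟨_, .lead hg.symm hp, fun _ _ => ih h rfl rfl⟩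

/-- Loop rule: `W` is an invariant that each call restores for the next one. -/
lemma within_collect {f : β → Prog (List γ)} {B : ℕ} {W : Situation V → Prop}
    {S : β → γ → Prop} {l : List β}
    (h : ∀ b ∈ l, ∀ w, W w → (f b).Within I w B fun r w' => W w' ∧ ∀ c, c ∈ r ↔ S b c)
    (hw : W w) : (collect f l).Within I w (l.length * B) fun r w' =>
      W w' ∧ ∀ c, c ∈ r ↔ ∃ b ∈ l, S b c := by
  induction l generalizing w with
  | nil => exact ⟨hw, by simp⟩
  | cons b l ih =>
    have hB : (b :: l).length * B = B + (l.length * B + 0) := by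
      simp only [List.length_cons]; ring
    rw [hB]
    refine (h b (by simp) w hw).bind fun r w₁ h₁ => ?_
    refine (ih (fun b' hb' => h b' (by simp [hb'])) h₁.1).bind fun s w₂ h₂ => ?_
    exact within_pure ⟨h₂.1, by simp [h₁.2, h₂.2]⟩

end Prog

/-! ### Exploration -/

section Exploration

open Prog

variable {V : Type} {k : ℕ} (I : Instance V k) (root : V)

/-- The record `x` describes the node `u`. -/
structure Record.At (x : Record) (u : V) : Prop where
  path : I.net.follow root x.path = some u
  back : I.net.follow u x.back = some root
  degree : x.degree = I.net.deg u
  capacity : x.capacity = I.cap u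

/-- Port `p` of the node recorded by `x` and port `r` of the node recorded by `y` belong to one
edge. -/
def Linked (x : Record) (p : ℕ) (y : Record) (r : ℕ) : Prop :=
  ∃ u v, x.At I root u ∧ y.At I root v ∧ I.net.traverse u p = some (v, r)

variable {I root}

lemma Linked.symm {x y : Record} {p r : ℕ} (h : Linked I root x p y r) :
    Linked I root y r x p := by
  obtain ⟨u, v, hx, hy, h⟩ := h
  exact ⟨v, u, hy, hx, I.net.traverse_symm h⟩

/-- Following ports is deterministic, so a path names one node. This is why marks may refer to nodes
by paths. -/
lemma Record.At.unique {x y : Record} {u v : V} (hx : x.At I root u) (hy : y.At I root v)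
    (h : x.path = y.path) : u = v :=
  Option.some.inj (hx.path.symm.trans (h ▸ hy.path))

lemma not_linked_self {x : Record} {p r : ℕ} : ¬ Linked I root x p x r := by
  rintro ⟨u, v, hx, hy, h⟩
  obtain rfl := hx.unique hy rfl
  exact (I.net.adj_of_traverse h).ne rfl

/-- Since the flock stands on `v` only, meeting it behind port `p` means that `p` leads to `v`, and
the port of arrival is the other end of the edge. -/
lemma within_probe {x y : Record} {u v : V} {p : ℕ} {w : Situation V} (hx : x.At I root u)
    (hy : y.At I root v) (hp : p < I.net.deg u) (hw : w.leader = u ∧ w.flock = v) :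
    (probe k y x p).Within I w 3 fun m w' => (w'.leader = u ∧ w'.flock = v) ∧
      ∀ c, c ∈ m ↔ ∃ r, Linked I root x p y r ∧ (c = (x.path, p) ∨ c = (y.path, r)) := by
  obtain ⟨rfl, rfl⟩ := hw
  obtain ⟨u', r, hp⟩ := I.net.exists_traverse hp
  refine (within_go (.solo hp)).bind (C := 1 + 0) fun o w₁ ⟨ho, h₁, h₂⟩ => ?_
  have hentry : o.view.entry.getD 0 = r := by simp [ho.view]
  rw [hentry]
  have hback : I.net.follow w₁.leader [r] = some w.leader := by
    simp [PortGraph.follow, h₁, I.net.traverse_symm hp]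
  refine (within_walk_solo hback rfl h₂).bind fun _ w₂ h₂ => within_pure ⟨h₂, fun c => ?_⟩
  have hiff := ho.flock_iff
  by_cases hc : u' = w.flock
  · rw [if_pos (hiff.2 hc)]
    subst hc
    simp only [List.mem_cons, List.not_mem_nil, or_false]
    refine ⟨fun h => ⟨r, ⟨_, _, hx, hy, hp⟩, h⟩, ?_⟩
    rintro ⟨r', ⟨u₁, v₁, hx', hy', h'⟩, h⟩
    obtain rfl := hx.unique hx' rfl
    rw [hp] at h'
    cases h'
    exact h
  · rw [if_neg fun h => hc (hiff.1 h)]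
    simp only [List.not_mem_nil, false_iff]
    rintro ⟨r', ⟨u₁, v₁, hx', hy', h'⟩, -⟩
    obtain rfl := hx.unique hx' rfl
    obtain rfl := hy.unique hy' rfl
    rw [hp] at h'
    cases h'
    exact hc rfl

/-- The budget `5n` is `n` rounds each way between the root and `x`, and 3 for each of at most `n`
ports. -/
lemma within_inspect [Fintype V] {x y : Record} {u v : V} {w : Situation V} (hx : x.At I root u)
    (hy : y.At I root v) (hpath : x.path.length ≤ Fintype.card V)
    (hback : x.back.length ≤ Fintype.card V) (hw : w.leader = root ∧ w.flock = v) :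
    (inspect k y x).Within I w (5 * Fintype.card V) fun m w' =>
      (w'.leader = root ∧ w'.flock = v) ∧
      ∀ c, c ∈ m ↔ ∃ p r, Linked I root x p y r ∧ (c = (x.path, p) ∨ c = (y.path, r)) := by
  have hdeg := I.net.deg_le_card u
  refine Within.mono (Q := fun m w' => (w'.leader = root ∧ w'.flock = v) ∧
    ∀ c, c ∈ m ↔ ∃ p ∈ List.range x.degree, ∃ r, Linked I root x p y r ∧
      (c = (x.path, p) ∨ c = (y.path, r))) ((within_walk_solo hx.path hw.1 hw.2).bind fun _ w₁ h₁ =>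
    (within_collect (W := fun w => w.leader = u ∧ w.flock = v) (fun p hp w hw =>
      within_probe hx hy (by rw [← hx.degree]; simpa using hp) hw) h₁).bind fun m w₂ h₂ =>
    (within_walk_solo hx.back h₂.1.1 h₂.1.2).bind fun _ w₃ h₃ => within_pure ⟨h₃, h₂.2⟩)
    ?_ fun m w' h => ⟨h.1, fun c => ?_⟩
  · rw [List.length_range, hx.degree]
    omega
  · rw [h.2 c]
    constructor
    · rintro ⟨p, -, r, h⟩
      exact ⟨p, r, h⟩
    · rintro ⟨p, r, h, hc⟩
      refine ⟨p, ?_, r, h, hc⟩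
      obtain ⟨u₁, v₁, hx', hy', h'⟩ := h
      rw [List.mem_range, hx'.degree]
      exact I.net.lt_deg_of_traverse h'

/-- At most `n` inspections of `5n` rounds each, and three walks of at most `n` rounds between `y`
and the root. -/
lemma within_survey [Fintype V] {y : Record} {N : List Record} {v : V} {w : Situation V}
    (hy : y.At I root v) (hN : ∀ x ∈ y :: N, ∃ u, x.At I root u)
    (hpath : ∀ x ∈ y :: N, x.path.length ≤ Fintype.card V)
    (hback : ∀ x ∈ y :: N, x.back.length ≤ Fintype.card V)
    (hlen : (y :: N).length ≤ Fintype.card V) (hw : w.leader = v ∧ w.flock = v) :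
    (survey k y (y :: N)).Within I w (5 * Fintype.card V ^ 2 + 3 * Fintype.card V) fun m w' =>
      (w'.leader = root ∧ w'.flock = root) ∧
      ∀ c, c ∈ m ↔ ∃ x ∈ y :: N, ∃ p r, Linked I root x p y r ∧
        (c = (x.path, p) ∨ c = (y.path, r)) := by
  have h₁ := hpath y (by simp)
  have h₂ := hback y (by simp)
  refine Within.mono ((within_walk_solo hy.back hw.1 hw.2).bind fun _ w₁ h₁ =>
    (within_collect (W := fun w => w.leader = root ∧ w.flock = v) (fun x hx w hw =>
      within_inspect (hN x hx).choose_spec hy (hpath x hx) (hback x hx) hw) h₁).bind fun m w₂ h₂ =>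
    (within_walk_solo hy.path h₂.1.1 h₂.1.2).bind fun _ w₃ h₃ =>
    (within_walk_lead hy.back h₃.1 h₃.2).bind fun _ w₄ h₄ => within_pure ⟨h₄, h₂.2⟩)
    ?_ fun m w' h => h
  nlinarith [Nat.mul_le_mul_right (5 * Fintype.card V) hlen]

lemma within_discover {x : Record} {u v : V} {p r : ℕ} {w : Situation V} (hx : x.At I root u)
    (hp : I.net.traverse u p = some (v, r)) (hw : w.leader = root ∧ w.flock = root) :
    (discover x p).Within I w (x.path.length + 2) fun y w' =>
      (w'.leader = v ∧ w'.flock = v) ∧ y.At I root v ∧ y.path.length = x.path.length + 1 ∧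
        y.back.length = x.back.length + 1 := by
  refine (within_walk_lead hx.path hw.1 hw.2).bind (C := 2 + 0) fun _ w₁ ⟨h₁, h₂⟩ => ?_
  subst h₁
  refine (within_go (.lead h₂.symm hp)).bind fun o w₂ ⟨ho, h₃, h₄⟩ => within_pure ?_
  refine ⟨⟨h₃, h₄⟩, ⟨?_, ?_, ?_, ?_⟩, by simp, by simp⟩
  · simp [I.net.follow_append hx.path, PortGraph.follow, hp]
  · simp [ho.view, PortGraph.follow, I.net.traverse_symm hp, hx.back]
  · simp [ho.view]
  · simp [ho.view]

variable (I root) in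
/-- The records describe distinct nodes, the root among them, and the recorded paths are short. -/
structure Recorded (N : List Record) : Prop where
  at_node : ∀ x ∈ N, ∃ u, x.At I root u
  path_lt : ∀ x ∈ N, x.path.length < N.length
  back_lt : ∀ x ∈ N, x.back.length < N.length
  nodup : (N.map fun x => I.net.follow root x.path).Nodup
  root_mem : ∃ x ∈ N, x.At I root root

variable (I root) in
/-- The invariant of the exploration: the marked ports are those between recorded nodes. -/
structure Explored (N : List Record) (M : List PortMark) : Prop extends Recorded I root N where
  marks : ∀ c, c ∈ M ↔ ∃ x ∈ N, ∃ y ∈ N, ∃ p r, Linked I root x p y r ∧ c = (x.path, p)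

variable {N : List Record} {M : List PortMark}

/-- Distinct records lead to distinct nodes; this bounds both the number of discoveries and the
lengths of the recorded paths. -/
lemma Recorded.length_le [Fintype V] (h : Recorded I root N) : N.length ≤ Fintype.card V := by
  classical
  have hsub : (N.map fun x => I.net.follow root x.path).toFinset ⊆ Finset.univ.image some := by
    intro a ha
    obtain ⟨x, hx, rfl⟩ := List.mem_map.1 (List.mem_toFinset.1 ha)
    obtain ⟨u, hu⟩ := h.at_node x hx
    simp [hu.path]
  have := Finset.card_le_card hsub
  rwa [List.toFinset_card_of_nodup h.nodup, List.length_map,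
    Finset.card_image_of_injective _ (Option.some_injective V), Finset.card_univ] at this

lemma Recorded.cons (h : Recorded I root N) {y : Record} {v : V} (hy : y.At I root v)
    (hnew : ∀ x ∈ N, ¬ x.At I root v) (hpath : y.path.length ≤ N.length)
    (hback : y.back.length ≤ N.length) : Recorded I root (y :: N) where
  at_node := by
    simpa using ⟨⟨v, hy⟩, h.at_node⟩
  path_lt := by
    simpa [Nat.lt_succ_iff] using ⟨hpath, fun x hx => (h.path_lt x hx).le⟩
  back_lt := by
    simpa [Nat.lt_succ_iff] using ⟨hback, fun x hx => (h.back_lt x hx).le⟩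
  nodup := by
    refine List.nodup_cons.2 ⟨fun hmem => ?_, h.nodup⟩
    obtain ⟨x, hx, e⟩ := List.mem_map.1 hmem
    obtain ⟨u, hu⟩ := h.at_node x hx
    obtain rfl : u = v := Option.some.inj (hu.path.symm.trans (e.trans hy.path))
    exact hnew x hx hu
  root_mem := by
    obtain ⟨x, hx, h⟩ := h.root_mem
    exact ⟨x, by simp [hx], h⟩

/-- An edge between recorded nodes either has `y` as an end, and the survey marks both its ports, or
was marked before. -/
lemma Explored.cons (h : Explored I root N M) {y : Record} (hN : Recorded I root (y :: N))
    {m : List PortMark} (hm : ∀ c, c ∈ m ↔ ∃ x ∈ y :: N, ∃ p r, Linked I root x p y r ∧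
        (c = (x.path, p) ∨ c = (y.path, r))) :
    Explored I root (y :: N) (m ++ M) where
  toRecorded := hN
  marks c := by
    rw [List.mem_append, hm, h.marks]
    constructor
    · rintro (⟨x, hx, p, r, hl, rfl | rfl⟩ | ⟨x, hx, x', hx', p, r, hl⟩)
      · exact ⟨x, hx, y, by simp, p, r, hl, rfl⟩
      · exact ⟨y, by simp, x, hx, r, p, hl.symm, rfl⟩
      · exact ⟨x, by simp [hx], x', by simp [hx'], p, r, hl⟩
    · rintro ⟨x, hx, x', hx', p, r, hl, rfl⟩
      rcases List.mem_cons.1 hx' with rfl | hx'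
      · exact .inl ⟨x, hx, p, r, hl, .inl rfl⟩
      · rcases List.mem_cons.1 hx with rfl | hx
        · exact .inl ⟨x', by simp [hx'], r, p, hl.symm, .inr rfl⟩
        · exact .inr ⟨x, hx, x', hx', p, r, hl, rfl⟩

/-- If every port of a recorded node is marked, the recorded nodes are closed under adjacency; they
contain the root and the graph is connected. -/
lemma Explored.complete (h : Explored I root N M) (hc : I.net.graph.Connected)
    (ho : openPort N M = none) (v : V) : ∃ x ∈ N, x.At I root v := by
  have key : ∀ u v, (∃ x ∈ N, x.At I root u) → I.net.graph.Adj u v → ∃ x ∈ N, x.At I root v := by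
    rintro u v ⟨x, hx, hu⟩ hadj
    obtain ⟨p, r, hp⟩ := I.net.exists_traverse_of_adj hadj
    have hmem : (x.path, p) ∈ M := by
      have := List.find?_eq_none.1 ho (x, p) (by
        simp only [List.mem_flatMap, List.mem_map, List.mem_range]
        exact ⟨x, hx, p, by rw [hu.degree]; exact I.net.lt_deg_of_traverse hp, rfl⟩)
      simpa using this
    obtain ⟨x', -, y, hy, p', r', ⟨u', v', hx', hy', hl⟩, e⟩ := (h.marks _).1 hmem
    obtain ⟨e₁, rfl⟩ := Prod.mk.inj e
    obtain rfl := hu.unique hx' e₁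
    rw [hp] at hl
    cases hl
    exact ⟨y, hy, hy'⟩
  obtain ⟨p⟩ := hc.preconnected root v
  have : ∀ u v, I.net.graph.Walk u v → (∃ x ∈ N, x.At I root u) → ∃ x ∈ N, x.At I root v := by
    intro u v p
    induction p with
    | nil => exact id
    | cons hadj _ ih => exact fun hu => ih (key _ _ hu hadj)
  exact this root v p h.root_mem

lemma within_explore [Fintype V] (hc : I.net.graph.Connected) (t : ℕ) (h : Explored I root N M)
    (ht : Fintype.card V < t + N.length) {w : Situation V}
    (hw : w.leader = root ∧ w.flock = root) :
    (explore k t N M).Within I w (t * (11 * Fintype.card V ^ 2)) fun N' w' =>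
      (w'.leader = root ∧ w'.flock = root) ∧ Recorded I root N' ∧
        ∀ v, ∃ x ∈ N', x.At I root v := by
  induction t generalizing N M w with
  -- By `ht`, running out of fuel would mean more than `n` records.
  | zero => exact absurd h.length_le (by omega)
  | succ t ih =>
    unfold explore
    split
    · rename_i ho
      exact (within_pure ⟨hw, h.toRecorded, h.complete hc ho⟩).mono (Nat.zero_le _) fun _ _ h => h
    · rename_i x p ho
      have hmem := List.mem_of_find?_eq_some ho
      simp only [List.mem_flatMap, List.mem_map, List.mem_range, Prod.mk.injEq] at hmem
      obtain ⟨x, hx, p, hp, rfl, rfl⟩ := hmem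
      have hopen : (x.path, p) ∉ M := by simpa using List.find?_some ho
      obtain ⟨u, hu⟩ := h.at_node x hx
      rw [hu.degree] at hp
      obtain ⟨v, r, hp⟩ := I.net.exists_traverse hp
      -- If the open port led to a recorded node, it would be marked.
      have hnew : ∀ z ∈ N, ¬ z.At I root v := fun z hz hz' =>
        hopen ((h.marks _).2 ⟨x, hx, z, hz, p, r, ⟨u, v, hu, hz', hp⟩, rfl⟩)
      have hcard := h.length_le
      have hpl := h.path_lt x hx
      have hbl := h.back_lt x hx
      refine Within.mono ((within_discover hu hp hw).bind
        (C := (5 * Fintype.card V ^ 2 + 3 * Fintype.card V) + t * (11 * Fintype.card V ^ 2))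
        fun y w₁ ⟨hw₁, hy, hyp, hyb⟩ => ?_) ?_ fun _ _ h => h
      · have hR := h.toRecorded.cons hy hnew (by omega) (by omega)
        refine (within_survey hy hR.at_node (fun z hz => (hR.path_lt z hz).le.trans hR.length_le)
          (fun z hz => (hR.back_lt z hz).le.trans hR.length_le) hR.length_le hw₁).bind
          fun m w₂ ⟨hw₂, hm⟩ => ih (h.cons hR hm) ?_ hw₂
        simp only [List.length_cons]
        omega
      -- One turn costs at most `(n + 1) + (5n² + 3n)` rounds, which is below `11n²` because `n ≥
      -- 1`.
      · have : 0 < Fintype.card V := Fintype.card_pos_iff.2 ⟨v⟩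
        nlinarith

end Exploration

/-! ### The assignment of places -/

lemma mem_slots {N : List Record} {s : Record × ℕ} :
    s ∈ slots N ↔ s.1 ∈ N ∧ s.2 < s.1.capacity := by
  obtain ⟨x, c⟩ := s
  simp only [slots, List.mem_flatMap, List.mem_map, List.mem_range, Prod.mk.injEq]
  constructor
  · rintro ⟨x, hx, c, hc, rfl, rfl⟩
    exact ⟨hx, hc⟩
  · rintro ⟨hx, hc⟩
    exact ⟨x, hx, c, hc, rfl, rfl⟩

lemma nodup_slots {N : List Record} (h : N.Nodup) : (slots N).Nodup := by
  refine List.nodup_flatMap.2 ⟨fun x _ => List.nodup_range.map (Prod.mk_right_injective x),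
    h.imp fun {x y} hne s hs hs' => hne ?_⟩
  obtain ⟨_, -, rfl⟩ := List.mem_map.1 hs
  obtain ⟨_, -, e⟩ := List.mem_map.1 hs'
  exact (congrArg Prod.fst e).symm

section Assignment

variable {V : Type} {k : ℕ} {I : Instance V k} {root : V} {N : List Record}

/-- Choosing a record for each node maps the pairs `(v, c)` with `c < cap v` injectively to places.
-/
lemma sum_cap_le_length_slots [Fintype V] (hN : ∀ v, ∃ x ∈ N, x.At I root v) :
    ∑ v, I.cap v ≤ (slots N).length := by
  classical
  choose x hx hat using hN
  calc ∑ v, I.cap v = (Finset.univ.sigma fun v => Finset.range (I.cap v)).card := by simp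
    _ ≤ (slots N).toFinset.card := by
      refine Finset.card_le_card_of_injOn (fun s => (x s.1, s.2)) (fun s hs => ?_) ?_
      · simp only [Finset.coe_sigma, Set.mem_sigma_iff, Finset.mem_coe, Finset.mem_range] at hs
        simpa [mem_slots, hx, (hat s.1).capacity] using hs.2
      · rintro ⟨v, c⟩ - ⟨v', c'⟩ - e
        obtain ⟨e₁, rfl⟩ := Prod.mk.inj e
        obtain rfl := (hat v).unique (hat v') (congrArg Record.path e₁)
        rfl
    _ ≤ (slots N).length := List.toFinset_card_le _

lemma exists_slot {S : Finset ℕ} (hS : S.card ≤ (slots N).length) {i : ℕ} (hi : i ∈ S) :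
    ∃ s ∈ slots N, (slots N)[(S.sort (· ≤ ·)).idxOf i]? = some s ∧ assign N S i = s.1.path := by
  have hlt : (S.sort (· ≤ ·)).idxOf i < (slots N).length := by
    refine lt_of_lt_of_le (List.idxOf_lt_length_of_mem ((Finset.mem_sort _).2 hi)) ?_
    rwa [Finset.length_sort]
  have := List.getElem?_eq_getElem hlt
  exact ⟨_, List.getElem_mem hlt, this, by simp [assign, this]⟩

/-- Labels go to places injectively, and all places on `u` come from the single record of `u`, which
offers `I.cap u` of them. -/
lemma card_assign_le (hR : Recorded I root N) (hN : ∀ v, ∃ x ∈ N, x.At I root v) {S : Finset ℕ}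
    (hS : S.card ≤ (slots N).length) (u : V) {T : Finset ℕ} (hT : T ⊆ S)
    (hu : ∀ i ∈ T, I.net.follow root (assign N S i) = some u) : T.card ≤ I.cap u := by
  classical
  obtain ⟨x, hx, hat⟩ := hN u
  have hnodup := nodup_slots hR.nodup.of_map
  calc T.card ≤ ((Finset.range (I.cap u)).image fun c => some (x, c)).card := by
        refine Finset.card_le_card_of_injOn (fun i => (slots N)[(S.sort (· ≤ ·)).idxOf i]?)
          (fun i hi => ?_) fun i hi j hj e => ?_
        · obtain ⟨⟨y, c⟩, hs, hsi, ha⟩ := exists_slot hS (hT hi)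
          obtain ⟨hy, hc⟩ := mem_slots.1 hs
          have hyu := hu i hi
          rw [ha] at hyu
          obtain rfl : y = x :=
            List.inj_on_of_nodup_map hR.nodup hy hx (hyu.trans hat.path.symm)
          rw [hat.capacity] at hc
          simpa [hsi] using hc
        · obtain ⟨s, -, hsi, -⟩ := exists_slot hS (hT hi)
          obtain ⟨hlt, -⟩ := List.getElem?_eq_some_iff.1 hsi
          exact (List.idxOf_inj ((Finset.mem_sort _).2 (hT hi))).1 ((List.getElem?_inj hlt hnodup).1 e)
    _ ≤ (Finset.range (I.cap u)).card := Finset.card_image_le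
    _ = I.cap u := Finset.card_range _

end Assignment

/-! ### Correctness of the algorithm -/

section Correctness

open Prog

variable {V : Type} [Fintype V] {k : ℕ} {I : Instance V k} {root : V}

lemma within_shepherdProg (hc : I.net.graph.Connected) (hcap : k ≤ ∑ v, I.cap v) {w : Situation V}
    (hw : w.leader = root ∧ w.flock = root) :
    (shepherdProg (Fintype.card V) k (I.id I.shepherd)).Within I w
      (1 + Fintype.card V * (11 * Fintype.card V ^ 2)) fun g w' =>
      (w'.leader = root ∧ w'.flock = root) ∧
      (∀ i ∉ I.byz, (g (I.id i)).length ≤ Fintype.card V ∧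
        ∃ v, I.net.follow root (g (I.id i)) = some v) ∧
      ∀ (u : V) (T : Finset ℕ), (∀ a ∈ T, ∃ i ∉ I.byz, I.id i = a) →
        (∀ a ∈ T, I.net.follow root (g a) = some u) → T.card ≤ I.cap u := by
  obtain ⟨rfl, hw⟩ := hw
  refine (within_observe (Q := fun o w' => w.Observes I o ∧
    (w'.leader = w.leader ∧ w'.flock = w.leader)) fun o ho => ⟨ho, rfl, hw⟩).bind
    (C := Fintype.card V * (11 * Fintype.card V ^ 2) + 0) fun o w₁ ⟨ho, hw₁⟩ => ?_
  set x₀ : Record := ⟨[], [], o.view.degree, o.view.capacity⟩ with hx₀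
  have hat : x₀.At I w.leader w.leader := ⟨rfl, rfl, by simp [hx₀, ho.view], by simp [hx₀, ho.view]⟩
  have hE : Explored I w.leader [x₀] [] :=
    { at_node := by simpa using ⟨_, hat⟩
      path_lt := by simp [hx₀]
      back_lt := by simp [hx₀]
      nodup := by simp
      root_mem := by simpa using hat
      marks := by simpa using fun _ _ _ r h => (not_linked_self h).elim }
  refine (within_explore hc _ hE (by simp) hw₁).bind fun N w₂ ⟨hw₂, hR, hN⟩ => within_pure ?_
  have hids : ∀ i ∉ I.byz, I.id i ∈ insert (I.id I.shepherd) o.labels.toFinset := fun i hi => by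
    by_cases e : i = I.shepherd
    · simp [e]
    · simp [ho.mem_labels hw.symm i hi e]
  -- Each robot shows one label per round, so at most `k - 1` are heard; with the shepherd's own
  -- there are at most `k`, hence no more than places.
  have hS : (insert (I.id I.shepherd) o.labels.toFinset).card ≤ (slots N).length := by
    have h₁ := Finset.card_insert_le (I.id I.shepherd) o.labels.toFinset
    have h₂ := Multiset.toFinset_card_le o.labels
    have h₃ := ho.card_lt
    have h₄ := sum_cap_le_length_slots hN
    omega
  refine ⟨hw₂, fun i hi => ?_, fun u T hT hu => card_assign_le hR hN hS u (fun a ha => ?_) hu⟩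
  · obtain ⟨s, hs, -, ha⟩ := exists_slot hS (hids i hi)
    have hsN := (mem_slots.1 hs).1
    rw [ha]
    obtain ⟨v, hv⟩ := hR.at_node s.1 hsN
    exact ⟨(hR.path_lt _ hsN).le.trans hR.length_le, v, hv.path⟩
  · obtain ⟨i, hi, rfl⟩ := hT a ha
    exact hids i hi

lemma simulates_zero {adv : Adversary Order k} (hstart : ∀ i, I.start i = root) :
    Simulates I adv 0 ⟨root, none, root⟩ (shepherdProg (Fintype.card V) k (I.id I.shepherd)) := by
  have h : ∀ i, run I adv 0 i = ⟨root, none, some (if i = I.shepherd then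
      .leading (I.id i) (shepherdProg (Fintype.card V) k (I.id i)) else .following (I.id i))⟩ :=
    fun i => by
      rw [← hstart i]
      rfl
  exact ⟨by simp [h], fun i _ _ => by simp [h], fun i _ hi => by simp [h, hi]⟩

/-- The dispersion algorithm solves Byzantine dispersion from a gathered configuration. -/
theorem solvesWithin_dispersionAlgorithm {f p q : ℕ} (hf : f < (k - 1) / 2) (hI : I.Valid f p q)
    (hG : I.Gathered) : SolvesWithin dispersionAlgorithm I (15 * Fintype.card V ^ 3) := by
  classical
  obtain ⟨root, hstart⟩ := hG
  have hs := hI.shepherd_honest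
  have hk : 2 * I.byz.card + 3 ≤ k := by
    have := hI.card_byz_le
    omega
  intro (adv : Adversary Order k)
  obtain ⟨t, ht, g, w, hsim, ⟨hl, hw⟩, hg, hcap⟩ :=
    (simulates_zero (adv := adv) hstart).exists_of_within hs hk
      (within_shepherdProg hI.connected hI.total_cap ⟨rfl, rfl⟩)
  have hfinal : ∀ i ∉ I.byz, (run I adv (t + Fintype.card V + 2) i).memory = none ∧
      I.net.follow root (g (I.id i)) = some (run I adv (t + Fintype.card V + 2) i).loc := by
    intro i hi
    obtain ⟨hloc, hmem⟩ := hsim.disperse hs (hl.trans hw.symm) i hi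
    obtain ⟨hlen, v, hv⟩ := hg i hi
    have := run_of_walking hi hmem (by rw [hloc, hw]; exact hv)
      (T := t + Fintype.card V + 2) (by omega)
    exact ⟨this.1, by rw [this.2, hv]⟩
  -- One round for the order to disperse, at most `n` for walking and one for terminating. With `t ≤
  -- 1 + 11n³`, the total is at most `11n³ + n + 3 ≤ 15n³`.
  refine ⟨t + Fintype.card V + 2, ?_, fun i hi => (hfinal i hi).1, fun u => ?_⟩
  · have h₀ : 0 < Fintype.card V := Fintype.card_pos_iff.2 ⟨root⟩
    have h₁ : Fintype.card V ≤ Fintype.card V ^ 3 := Nat.le_self_pow (by norm_num) _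
    have h₂ : Fintype.card V * (11 * Fintype.card V ^ 2) = 11 * Fintype.card V ^ 3 := by ring
    omega
  · set F := Finset.univ.filter fun i => i ∉ I.byz ∧ (run I adv (t + Fintype.card V + 2) i).loc = u
    have hF : F.card ≤ I.cap u := by
      -- Places are assigned to labels, so robots are counted by their IDs.
      rw [← Finset.card_image_of_injective F hI.id_injective]
      refine hcap u _ (fun a ha => ?_) fun a ha => ?_ <;>
      · obtain ⟨i, hi, rfl⟩ := Finset.mem_image.1 ha
        obtain ⟨-, hi, hu⟩ := Finset.mem_filter.1 hi
        first
        | exact ⟨i, hi, rfl⟩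
        | rw [(hfinal i hi).2, hu]
    refine (Finset.card_le_card fun i hi => ?_).trans hF
    exact Finset.mem_filter.2 ⟨Finset.mem_univ i, (Finset.mem_filter.1 hi).2⟩

end Correctness

end ByzantineDispersion

theorem mainTheorem2 :
    ∃ (A : ByzantineDispersion.Algorithm) (C : ℕ),
      ∀ (n k f p q : ℕ), 1 < k → 0 < p → 0 < q → f < (k - 1) / 2 →
        ∀ (V : Type) [Fintype V], Fintype.card V = n →
          ∀ I : ByzantineDispersion.Instance V k, I.Valid f p q → I.Gathered →
            ByzantineDispersion.SolvesWithin A I (C * n ^ 3) := by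
  refine ⟨ByzantineDispersion.dispersionAlgorithm, 15, ?_⟩
  rintro n k f p q - - - hf V _ rfl I hI hG
  exact ByzantineDispersion.solvesWithin_dispersionAlgorithm hf hI hG
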